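/- Two agents, one sender and one receiver, start at time $0$ at the origin of the real line and move with speed at most $1$; a trajectory is thus a map $X:[0,\infty)\to\mathbb{R}$ with $X(0)=0$ and $|X(t')-X(t)|\le t'-t$ for $t'\ge t\ge 0$. A target lies at an unknown location $x$. An agent can know the target's location at time $t$ if by time $t$ it has visited $x$ or has been notified by the other agent, where co-located agents can notify each other, and, in addition, the sender can at any distance instantaneously notify the receiver (but not conversely). An evacuation algorithm $\mathcal{A}$ assigns to each agent a search trajectory and specifies, for each target location $x$, the trajectory along which each agent actually moves; an agent must follow its assigned search trajectory as long as it has neither found the target nor been notified of it. Let $E(\mathcal{A},x)\in[0,\infty]$ be the time at which the last agent reaches the target at $x$, and let $$\mathrm{CR}(\mathcal{A})=\sup_{|x|>1}\frac{E(\mathcal{A},x)}{|x|}.$$ Let $\mathcal{A}_0$ be the following algorithm. The receiver moves to the left at unit speed and the sender moves to the right with speed $\sqrt2-1$. If the sender finds the target first, it immediately notifies the receiver wirelessly, and the receiver moves at unit speed to the target. If the receiver finds the target first, it moves at unit speed to the right until it reaches the sender, and then both agents move at unit speed back to the target. Then $\mathcal{A}_0$ is optimal: $\mathrm{CR}(\mathcal{A}_0)=3+2\sqrt2$,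 and $\mathrm{CR}(\mathcal{A}_0)\le\mathrm{CR}(\mathcal{A})$ for every evacuation algorithm $\mathcal{A}$ for one sender and one receiver. -/

import Mathlib

open scoped NNReal ENNReal

noncomputable section

/-- The two agents: the sender can transmit but not receive wirelessly, the receiver can receive
but not transmit wirelessly. Both can communicate when they are co-located. -/
inductive Agent where
  | sender
  | receiver

/-- A trajectory on the line: it starts at the origin and has speed at most `1`. -/
structure IsTrajectory (X : ℝ≥0 → ℝ) : Prop where
  start : X 0 = 0
  speed : ∀ t t' : ℝ≥0, t ≤ t' → |X t' - X t| ≤ (t' : ℝ) - t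

/-- `Knows X x i t`: if the target is at `x` and the agents actually move along the trajectories
`X`, then at time `t` agent `i` can know the location of the target, either because it has found
the target or because it has been notified of it (face-to-face, or wirelessly when the information
goes from the sender to the receiver). -/
inductive Knows (X : Agent → ℝ≥0 → ℝ) (x : ℝ) : Agent → ℝ≥0 → Prop
  | found {i : Agent} {t : ℝ≥0} : X i t = x → Knows X x i t
  | remember {i : Agent} {s t : ℝ≥0} : s ≤ t → Knows X x i s → Knows X x i t
  | faceToFace {i j : Agent} {t : ℝ≥0} : X i t = X j t → Knows X x i t → Knows X x j t
  | wireless {t : ℝ≥0} : Knows X x Agent.sender t → Knows X x Agent.receiver t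

/-- An evacuation algorithm for one sender and one receiver. It assigns to each agent a search
trajectory, and it specifies how the agents move once they know where the target is: `run x i` is
the trajectory along which agent `i` actually moves when the target is at `x`. An agent follows its
assigned search trajectory as long as it has neither found the target nor been notified of it. -/
structure EvacuationAlgorithm where
  search : Agent → ℝ≥0 → ℝ
  run : ℝ → Agent → ℝ≥0 → ℝ
  search_isTrajectory : ∀ i, IsTrajectory (search i)
  run_isTrajectory : ∀ x i, IsTrajectory (run x i)
  follows : ∀ x i t, ¬ Knows (run x) x i t → run x i t = search i t

namespace EvacuationAlgorithm

/-- The time at which agent `i` first reaches the target at `x` (`∞` if it never does). -/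
def arrivalTime (A : EvacuationAlgorithm) (x : ℝ) (i : Agent) : ℝ≥0∞ :=
  ⨅ (t : ℝ≥0) (_ : A.run x i t = x), (t : ℝ≥0∞)

/-- The evacuation time: the time at which the last agent reaches the target at `x`. -/
def evacuationTime (A : EvacuationAlgorithm) (x : ℝ) : ℝ≥0∞ :=
  ⨆ i, A.arrivalTime x i

/-- The competitive ratio: the supremum over all `|x| > 1` of the evacuation time over `|x|`. -/
def competitiveRatio (A : EvacuationAlgorithm) : ℝ≥0∞ :=
  ⨆ (x : ℝ) (_ : 1 < |x|), A.evacuationTime x / ENNReal.ofReal |x|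

end EvacuationAlgorithm

/-- The position, `d` time units later, of an agent that starts from `p`, moves at unit speed to
`q` and stays there. -/
def goTo (p q d : ℝ) : ℝ := if p ≤ q then min q (p + d) else max q (p - d)

/-- The search trajectories: the sender moves to the right with speed `√2 - 1`, the receiver moves
to the left with speed `1`. -/
def optSearch : Agent → ℝ≥0 → ℝ
  | .sender, t => (√2 - 1) * t
  | .receiver, t => -t

/-- The time at which the sender finds a target at `x ≥ 0`. -/
def senderFindTime (x : ℝ) : ℝ := x / (√2 - 1)

/-- The time at which the receiver, having found a target at `x < 0` at time `-x` and then moving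
to the right at unit speed, reaches the sender; see `meetTime_spec`. -/
def meetTime (x : ℝ) : ℝ := (2 + √2) * (-x)

/-- The actual trajectories when the target is at `x`. If `x ≥ 0`, the sender finds the target and
stays there, and the receiver, notified wirelessly at that moment, moves at unit speed to the
target. If `x < 0`, the receiver finds the target, moves at unit speed to the right until it reaches
the sender, and then both agents move at unit speed back to the target. -/
def optRun (x : ℝ) : Agent → ℝ≥0 → ℝ
  | .sender, t =>
    if 0 ≤ x then
      if (t : ℝ) ≤ senderFindTime x then (√2 - 1) * t else x
    else
      if (t : ℝ) ≤ meetTime x then (√2 - 1) * t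
      else goTo ((√2 - 1) * meetTime x) x (t - meetTime x)
  | .receiver, t =>
    if 0 ≤ x then
      if (t : ℝ) ≤ senderFindTime x then -t
      else goTo (-senderFindTime x) x (t - senderFindTime x)
    else
      if (t : ℝ) ≤ -x then -t
      else if (t : ℝ) ≤ meetTime x then x + (t - -x)
      else goTo ((√2 - 1) * meetTime x) x (t - meetTime x)

theorem sqrt_two_mul_self : √2 * √2 = (2 : ℝ) := Real.mul_self_sqrt (by norm_num)

theorem one_lt_sqrt_two : 1 < √2 := by
  nlinarith [sqrt_two_mul_self, Real.sqrt_nonneg 2]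

theorem sqrt_two_lt_two : √2 < 2 := by
  nlinarith [sqrt_two_mul_self, Real.sqrt_nonneg 2]

theorem speed_mul_senderFindTime (x : ℝ) : (√2 - 1) * senderFindTime x = x := by
  have h := one_lt_sqrt_two
  unfold senderFindTime
  rw [mul_div_cancel₀]
  linarith

theorem senderFindTime_nonneg {x : ℝ} (hx : 0 ≤ x) : 0 ≤ senderFindTime x :=
  div_nonneg hx (by linarith [one_lt_sqrt_two])

theorem meetTime_spec (x : ℝ) : x + (meetTime x - -x) = (√2 - 1) * meetTime x := by
  unfold meetTime
  linear_combination (-x) * (-sqrt_two_mul_self)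

theorem neg_le_meetTime {x : ℝ} (hx : x < 0) : -x ≤ meetTime x := by
  unfold meetTime
  nlinarith [one_lt_sqrt_two]

theorem goTo_zero (p q : ℝ) : goTo p q 0 = p := by
  unfold goTo
  split_ifs with h
  · simpa using h
  · simpa using le_of_not_ge h

theorem goTo_speed (p q : ℝ) {d e : ℝ} (h : d ≤ e) : |goTo p q e - goTo p q d| ≤ e - d := by
  unfold goTo
  split_ifs
  · calc _ ≤ |(p + e) - (p + d)| := by
          simpa using abs_min_sub_min_le_max q (p + e) q (p + d)
      _ = e - d := by rw [add_sub_add_left_eq_sub, abs_of_nonneg (by linarith)]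
  · calc _ ≤ |(p - e) - (p - d)| := by
          simpa using abs_max_sub_max_le_max q (p - e) q (p - d)
      _ = e - d := by
          rw [show (p - e) - (p - d) = -(e - d) by ring, abs_neg, abs_of_nonneg (by linarith)]

/-- Unit-speed motions that agree at time `a` can be concatenated there. -/
theorem ite_speed {f g : ℝ → ℝ} {a : ℝ} (hf : ∀ s t, s ≤ t → |f t - f s| ≤ t - s)
    (hg : ∀ s t, s ≤ t → |g t - g s| ≤ t - s) (h : f a = g a) (s t : ℝ) (hst : s ≤ t) :
    |(if t ≤ a then f t else g t) - (if s ≤ a then f s else g s)| ≤ t - s := by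
  split_ifs with h1 h2 h2
  · exact hf s t hst
  · linarith
  · have h3 := hf s a h2
    have h4 := hg a t (le_of_not_ge h1)
    rw [h] at h3
    calc _ = |(g t - g a) + (g a - f s)| := by ring_nf
      _ ≤ |g t - g a| + |g a - f s| := abs_add_le _ _
      _ ≤ t - s := by linarith
  · exact hg s t hst

theorem slow_speed (s t : ℝ) (h : s ≤ t) : |(√2 - 1) * t - (√2 - 1) * s| ≤ t - s := by
  have h1 := one_lt_sqrt_two
  have h2 := sqrt_two_lt_two
  rw [abs_of_nonneg (by nlinarith)]
  nlinarith

theorem left_speed (s t : ℝ) (h : s ≤ t) : |-t - -s| ≤ t - s := by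
  rw [show -t - -s = -(t - s) by ring, abs_neg, abs_of_nonneg (by linarith)]

theorem right_speed (x s t : ℝ) (h : s ≤ t) : |(x + (t - -x)) - (x + (s - -x))| ≤ t - s := by
  rw [show (x + (t - -x)) - (x + (s - -x)) = t - s by ring, abs_of_nonneg (by linarith)]

theorem goTo_delay_speed (p q a s t : ℝ) (h : s ≤ t) :
    |goTo p q (t - a) - goTo p q (s - a)| ≤ t - s := by
  simpa using goTo_speed p q (show s - a ≤ t - a by linarith)

theorem optSearch_isTrajectory (i : Agent) : IsTrajectory (optSearch i) := by
  cases i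
  · exact ⟨by simp [optSearch], fun t t' h => slow_speed t t' (by exact_mod_cast h)⟩
  · exact ⟨by simp [optSearch], fun t t' h => left_speed t t' (by exact_mod_cast h)⟩

theorem optRun_isTrajectory (x : ℝ) (i : Agent) : IsTrajectory (optRun x i) := by
  rcases le_or_gt 0 x with hx | hx
  · have h0 := senderFindTime_nonneg hx
    cases i
    · refine ⟨by simp [optRun, hx, h0], fun t t' h => ?_⟩
      simp only [optRun, if_pos hx]
      exact ite_speed (f := fun t => (√2 - 1) * t) (g := fun _ => x) slow_speed
        (fun s t h => by simpa using h) (speed_mul_senderFindTime x) t t' (by exact_mod_cast h)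
    · refine ⟨by simp [optRun, hx, h0], fun t t' h => ?_⟩
      simp only [optRun, if_pos hx]
      exact ite_speed (f := fun t => -t)
        (g := fun t => goTo (-senderFindTime x) x (t - senderFindTime x)) left_speed
        (goTo_delay_speed _ _ _) (by simp [goTo_zero]) t t' (by exact_mod_cast h)
  · have hx' : ¬ 0 ≤ x := not_le.mpr hx
    have h1 := neg_le_meetTime hx
    have h0 : 0 ≤ meetTime x := by linarith
    cases i
    · refine ⟨by simp [optRun, hx', h0], fun t t' h => ?_⟩
      simp only [optRun, if_neg hx']
      exact ite_speed (f := fun t => (√2 - 1) * t)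
        (g := fun t => goTo ((√2 - 1) * meetTime x) x (t - meetTime x)) slow_speed
        (goTo_delay_speed _ _ _) (by simp [goTo_zero]) t t' (by exact_mod_cast h)
    · refine ⟨by simp [optRun, hx', hx.le], fun t t' h => ?_⟩
      simp only [optRun, if_neg hx']
      exact ite_speed (f := fun t => -t)
        (g := fun t => if t ≤ meetTime x then x + (t - -x)
          else goTo ((√2 - 1) * meetTime x) x (t - meetTime x)) left_speed
        (ite_speed (f := fun t => x + (t - -x)) (right_speed x) (goTo_delay_speed _ _ _)
          (by simpa [goTo_zero] using meetTime_spec x))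
        (by simp [h1]) t t' (by exact_mod_cast h)

theorem optRun_follows (x : ℝ) (i : Agent) (t : ℝ≥0) (h : ¬ Knows (optRun x) x i t) :
    optRun x i t = optSearch i t := by
  by_contra hne
  apply h
  rcases le_or_gt 0 x with hx | hx
  · have h0 := senderFindTime_nonneg hx
    have hlt : senderFindTime x < t := by
      by_contra hle
      rw [not_lt] at hle
      cases i <;> simp [optRun, optSearch, hx, hle] at hne
    obtain ⟨a, ha⟩ : ∃ a : ℝ≥0, (a : ℝ) = senderFindTime x := ⟨⟨_, h0⟩, rfl⟩
    have hS : Knows (optRun x) x .sender a :=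
      .found (by simpa [optRun, hx, ha] using speed_mul_senderFindTime x)
    have hle : a ≤ t := by
      rw [← NNReal.coe_le_coe, ha]
      exact hlt.le
    cases i
    · exact .remember hle hS
    · exact .remember hle (.wireless hS)
  · have hx' : ¬ 0 ≤ x := not_le.mpr hx
    have h1 := neg_le_meetTime hx
    have h0 : 0 ≤ meetTime x := by linarith
    obtain ⟨a, ha⟩ : ∃ a : ℝ≥0, (a : ℝ) = -x := ⟨⟨-x, by linarith⟩, rfl⟩
    obtain ⟨b, hb⟩ : ∃ b : ℝ≥0, (b : ℝ) = meetTime x := ⟨⟨_, h0⟩, rfl⟩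
    have hR : Knows (optRun x) x .receiver a := .found (by simp [optRun, hx', ha])
    cases i
    · have hlt : meetTime x < t := by
        by_contra hle
        rw [not_lt] at hle
        simp [optRun, optSearch, hx', hle] at hne
      have h2 : -x < meetTime x := by
        unfold meetTime
        nlinarith [one_lt_sqrt_two]
      refine .remember (s := b) ?_ (.faceToFace (i := .receiver) ?_ (.remember (s := a) ?_ hR))
      · rw [← NNReal.coe_le_coe, hb]
        exact hlt.le
      · simpa [optRun, hx', hb, not_le.mpr h2] using meetTime_spec x
      · rw [← NNReal.coe_le_coe, ha, hb]
        exact h1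
    · have hlt : -x < t := by
        by_contra hle
        rw [not_lt] at hle
        simp [optRun, optSearch, hx', hle] at hne
      refine .remember (s := a) ?_ hR
      rw [← NNReal.coe_le_coe, ha]
      exact hlt.le

/-- The evacuation algorithm for one sender and one receiver: the receiver moves to the left at
unit speed and the sender moves to the right with speed `√2 - 1`. If the sender finds the target
first, it notifies the receiver wirelessly, and the receiver moves at unit speed to the target. If
the receiver finds the target first, it moves at unit speed to the right until it reaches the
sender, and then both agents move at full speed back to the target. -/
def optAlgorithm : EvacuationAlgorithm where
  search := optSearch
  run := optRun
  search_isTrajectory := optSearch_isTrajectory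
  run_isTrajectory := optRun_isTrajectory
  follows := optRun_follows

end

/-! Suppose every `x` with `|x| > 1` is evacuated before time `c|x|`, where `5 ≤ c < 3 + 2√2`. Let
an agent's search trajectory be at `p` at a late time `t`, and take `x` on the other side of the
origin with `t + |p| + |x| = c|x|`. An ignorant agent would be too late for `x`, so it must already
know. Hence some search trajectory visited `x` at a time `s ≤ t`, and unless the sender informs the
receiver, the news had to cross the distance physically: `|p| + |x| ≤ t - s`
(`exists_earlier_visit`).

These constraints bootstrap. If eventually `|R(t)| ≤ a t` and `(c - 1)|S(t)| ≤ (1 + a) t`, applying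
them at `t` and the bounds at `s` gives the same bounds with `a - e`, for a fixed `e > 0`
(`SearchBound.improve`). The decisive case is a sender relying on a receiver's visit: its quadratic
in `a` has discriminant `(c - 1)²(c² - 6c + 1)`, negative exactly because `c` is below the root `3 +
2√2`. Unit speed gives the start `a = c - 2`, and iteration makes `a` negative, which is absurd.

For the upper bound, both kinds of target cost `𝒜₀` exactly `(3 + 2√2)|x|` by its timetable. -/

namespace IsTrajectory

variable {X : ℝ≥0 → ℝ}

theorem continuous (hX : IsTrajectory X) : Continuous X := by
  refine (LipschitzWith.of_dist_le_mul (K := 1) fun s t => ?_).continuous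
  rw [NNReal.coe_one, one_mul, NNReal.dist_eq, Real.dist_eq]
  rcases le_total s t with h | h
  · rw [abs_sub_comm, abs_sub_comm (s : ℝ)]
    exact (hX.speed s t h).trans (le_abs_self _)
  · exact (hX.speed t s h).trans (le_abs_self _)

theorem abs_le (hX : IsTrajectory X) (t : ℝ≥0) : |X t| ≤ t := by
  simpa [hX.start] using hX.speed 0 t zero_le

theorem abs_sub_le (hX : IsTrajectory X) {s t : ℝ≥0} (h : s ≤ t) (x : ℝ) :
    |X t - x| ≤ |X s - x| + (t - s) := by
  have h1 := hX.speed s t h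
  have h2 := _root_.abs_sub_le (X t) (X s) x
  linarith

/-- Trajectories that agree before time `t` agree at time `t`. -/
theorem eq_of_forall_lt {Y : ℝ≥0 → ℝ} (hX : IsTrajectory X) (hY : IsTrajectory Y) {t : ℝ≥0}
    (h : ∀ s < t, X s = Y s) : X t = Y t := by
  rcases eq_or_ne t 0 with rfl | ht
  · rw [hX.start, hY.start]
  · have hsub : closure (Set.Iio t) ⊆ {s | X s = Y s} :=
      closure_minimal h (isClosed_eq hX.continuous hY.continuous)
    rw [closure_Iio' ⟨0, pos_iff_ne_zero.mpr ht⟩] at hsub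
    exact hsub (Set.mem_Iic.mpr le_rfl)

end IsTrajectory

/-- A nonempty closed set of times has a first element. -/
theorem exists_first_time {C : Set ℝ≥0} (hC : IsClosed C) {t : ℝ≥0} (ht : t ∈ C) :
    ∃ s ∈ C, s ≤ t ∧ ∀ u < s, u ∉ C :=
  ⟨sInf C, hC.csInf_mem ⟨t, ht⟩ (OrderBot.bddBelow C), csInf_le (OrderBot.bddBelow C) ht,
    fun _ hu => notMem_of_lt_csInf hu (OrderBot.bddBelow C)⟩

/-! ### How knowledge of the target spreads -/

/-- Knowledge of the target requires that some agent has visited it. -/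
theorem Knows.exists_found {X : Agent → ℝ≥0 → ℝ} {x : ℝ} {i : Agent} {t : ℝ≥0}
    (h : Knows X x i t) : ∃ s ≤ t, ∃ j, X j s = x := by
  induction h with
  | found h => exact ⟨_, le_rfl, _, h⟩
  | remember hst _ ih =>
    obtain ⟨s, hs, h⟩ := ih
    exact ⟨s, hs.trans hst, h⟩
  | faceToFace _ _ ih => exact ih
  | wireless _ ih => exact ih

/-- Before the sender knows the target, it has visited the target or met a receiver that knows
it. -/
theorem Knows.sender_source {X : Agent → ℝ≥0 → ℝ} {x : ℝ} {i : Agent} {t : ℝ≥0}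
    (h : Knows X x i t) (hi : i = .sender) :
    ∃ s ≤ t, Knows X x .sender s ∧
      (X .sender s = x ∨ Knows X x .receiver s ∧ X .sender s = X .receiver s) := by
  induction h with
  | found h =>
    subst hi
    exact ⟨_, le_rfl, .found h, .inl h⟩
  | remember hst _ ih =>
    obtain ⟨s, hs, h⟩ := ih hi
    exact ⟨s, hs.trans hst, h⟩
  | @faceToFace i j t hij hk ih =>
    subst hi
    cases i
    · exact ih rfl
    · exact ⟨t, le_rfl, .faceToFace hij hk, .inr ⟨hk, hij.symm⟩⟩
  | wireless => cases hi

namespace EvacuationAlgorithm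

variable (A : EvacuationAlgorithm)

/-- If an agent knows the target, then some agent has visited it on its search trajectory, at a
time that leaves enough time for the information to travel, at unit speed unless it goes from the
sender to the receiver. -/
theorem exists_search_of_knows {x : ℝ} {i : Agent} {t : ℝ≥0} (h : Knows (A.run x) x i t) :
    ∃ j, ∃ s ≤ t, A.search j s = x ∧
      (i = .receiver ∧ j = .sender ∨ |A.search i t - x| ≤ t - s) := by
  have hcont : ∀ i, Continuous (A.run x i) := fun i => (A.run_isTrajectory x i).continuous
  have hclosed : IsClosed {s : ℝ≥0 | ∃ j, A.run x j s = x} := by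
    have : {s : ℝ≥0 | ∃ j, A.run x j s = x} =
        {s | A.run x .sender s = x} ∪ {s | A.run x .receiver s = x} := by
      ext s
      constructor
      · rintro ⟨_ | _, hj⟩
        · exact .inl hj
        · exact .inr hj
      · rintro (hj | hj)
        · exact ⟨_, hj⟩
        · exact ⟨_, hj⟩
    rw [this]
    exact (isClosed_eq (hcont _) continuous_const).union (isClosed_eq (hcont _) continuous_const)
  obtain ⟨s₀, hs₀t, hs₀⟩ := h.exists_found
  -- Before the first visit `s` nobody knows anything, so the actual and search trajectories agree
  -- up to `s`, and this visit occurs on a search trajectory.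
  obtain ⟨s, ⟨j, hj⟩, hss₀, hfirst⟩ := exists_first_time hclosed (t := s₀) hs₀
  have hle : ∀ {k u}, Knows (A.run x) x k u → s ≤ u := by
    intro k u hk
    obtain ⟨v, hv, hv'⟩ := hk.exists_found
    exact (not_lt.mp fun hlt => hfirst v hlt hv').trans hv
  have hst : s ≤ t := hss₀.trans hs₀t
  have hsearch : A.search j s = x := by
    rw [← hj]
    refine ((A.run_isTrajectory x j).eq_of_forall_lt (A.search_isTrajectory j) fun u hu => ?_).symm
    exact A.follows x j u fun hk => (hle hk).not_gt hu
  have hself : |A.search j t - x| ≤ t - s := by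
    simpa [hsearch] using (A.search_isTrajectory j).abs_sub_le hst x
  refine ⟨j, s, hst, hsearch, ?_⟩
  cases i <;> cases j
  · exact .inr hself
  · right
    -- The sender may deviate from its search once informed, so the estimate is made at its first
    -- entry into the unit-speed cone issuing from `x` at time `s`. It is ignorant before that
    -- entry, hence still searching; afterwards unit speed keeps the search trajectory in the cone.
    have hC : IsClosed {u : ℝ≥0 | s ≤ u ∧ |A.run x .sender u - x| ≤ u - s} :=
      isClosed_Ici.inter (isClosed_le ((hcont _).sub continuous_const).abs
        (NNReal.continuous_coe.sub continuous_const))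
    have hmem : ∀ {u}, Knows (A.run x) x .sender u →
        ∃ v ≤ u, s ≤ v ∧ |A.run x .sender v - x| ≤ v - s := by
      intro u hu
      obtain ⟨v, hvu, hkv, hv⟩ := hu.sender_source rfl
      have hsv := hle hkv
      refine ⟨v, hvu, hsv, ?_⟩
      rcases hv with hv | ⟨-, hv⟩
      · simpa [hv] using hsv
      · rw [hv]
        simpa [hj] using (A.run_isTrajectory x .receiver).abs_sub_le hsv x
    obtain ⟨v, hvt, hv⟩ := hmem h
    obtain ⟨w, ⟨hsw, hw⟩, hwv, hwfirst⟩ := exists_first_time hC (t := v) hv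
    have heq : A.run x .sender w = A.search .sender w := by
      refine (A.run_isTrajectory x _).eq_of_forall_lt (A.search_isTrajectory _) fun u hu => ?_
      refine A.follows x _ u fun hk => ?_
      obtain ⟨v', hv', hv''⟩ := hmem hk
      exact hwfirst v' (hv'.trans_lt hu) hv''
    rw [heq] at hw
    have := (A.search_isTrajectory .sender).abs_sub_le (hwv.trans hvt) x
    linarith
  · exact .inl ⟨rfl, rfl⟩
  · exact .inr hself

/-! ### Visits forced by a small competitive ratio -/

theorem exists_run_eq_of_evacuationTime_lt {x c : ℝ}
    (h : A.evacuationTime x < ENNReal.ofReal c) (i : Agent) :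
    ∃ t : ℝ≥0, A.run x i t = x ∧ (t : ℝ) < c := by
  have h1 : A.arrivalTime x i < ENNReal.ofReal c := (le_iSup _ i).trans_lt h
  simp only [arrivalTime, iInf_lt_iff] at h1
  obtain ⟨t, ht, hlt⟩ := h1
  refine ⟨t, ht, ?_⟩
  rwa [← ENNReal.ofReal_coe_nnreal, ENNReal.ofReal_lt_ofReal_iff_of_nonneg t.coe_nonneg] at hlt

/-- An agent that has no knowledge of the target must still be able to reach it in time. -/
theorem knows_of_le {x c : ℝ} (h : A.evacuationTime x < ENNReal.ofReal c) {i : Agent} {t : ℝ≥0}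
    (hle : c ≤ t + |A.search i t - x|) : Knows (A.run x) x i t := by
  by_contra hk
  obtain ⟨s, hs, hsc⟩ := A.exists_run_eq_of_evacuationTime_lt h i
  have hts : t ≤ s := by
    by_contra hlt
    exact hk (.remember (not_le.mp hlt).le (.found hs))
  have := (A.run_isTrajectory x i).speed t s hts
  rw [hs, A.follows x i t hk, abs_sub_comm] at this
  linarith

variable {A}

/-- At every late time the searching agent relies on an earlier visit, by some agent, to a point on
the other side of the origin. -/
theorem exists_earlier_visit {c : ℝ} (hc : 1 < c)
    (hA : ∀ x : ℝ, 1 < |x| → A.evacuationTime x < ENNReal.ofReal (c * |x|))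
    (i : Agent) {t : ℝ≥0} (ht : c - 1 < t) :
    ∃ j, ∃ s ≤ t, (c - 1) * |A.search j s| = t + |A.search i t| ∧
      (i = .receiver ∧ j = .sender ∨ |A.search j s| + s ≤ t - |A.search i t|) := by
  have hc0 : 0 < c - 1 := by linarith
  set p := A.search i t
  -- `q` solves `t + |p| + q = c q`: from `p`, a target at distance `q` on the other side can be
  -- reached no earlier than its deadline.
  set q := (t + |p|) / (c - 1) with hqdef
  have hq : (c - 1) * q = t + |p| := by rw [hqdef]; field_simp
  have hq1 : 1 < q := by
    rw [hqdef, one_lt_div hc0]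
    linarith [abs_nonneg p]
  obtain ⟨x, hx, hpx⟩ : ∃ x : ℝ, |x| = q ∧ |p - x| = |p| + q := by
    rcases le_total 0 p with hp | hp
    · refine ⟨-q, by rw [abs_neg, abs_of_pos (by linarith)], ?_⟩
      rw [abs_of_nonneg hp, abs_of_nonneg (by linarith)]
      ring
    · refine ⟨q, abs_of_pos (by linarith), ?_⟩
      rw [abs_of_nonpos hp, abs_of_nonpos (by linarith)]
      ring
  have hk : Knows (A.run x) x i t := by
    refine A.knows_of_le (hA x (by rwa [hx])) ?_
    change _ ≤ (t : ℝ) + |p - x|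
    rw [hpx, hx]
    linarith
  obtain ⟨j, s, hs, hjs, hor⟩ := A.exists_search_of_knows hk
  refine ⟨j, s, hs, by rw [hjs, hx, hq], hor.imp_right fun h => ?_⟩
  change |p - x| ≤ _ at h
  rw [hjs, hx]
  linarith

/-! ### Shrinking the cones that contain the search trajectories -/

/-- From time `T` on, the receiver keeps within the cone of slope `a`, and the sender keeps within
the cone of slope `(1 + a) / (c - 1)`. -/
def SearchBound (A : EvacuationAlgorithm) (c a : ℝ) (T : ℝ≥0) : Prop :=
  ∀ t, T ≤ t → |A.search .receiver t| ≤ a * t ∧ (c - 1) * |A.search .sender t| ≤ (1 + a) * t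

/-- The discriminants of the three quadratics in `a` and `1 + a` are negative because
`c ^ 2 - 6 * c + 1 < 0`. -/
theorem improve_quadratics {c a e : ℝ} (hc : 5 ≤ c) (he : 0 < e)
    (hce : 1000 * e ≤ 6 * c - c ^ 2 - 1) (ha : a ≤ c - 2) :
    c < 6 ∧ e ≤ 1 / 250 ∧
      e * (1 + c * a) ≤ c * a ^ 2 - (c ^ 2 - 4 * c + 1) * a + c ∧
      e * ((c - 1) + c * (1 + a)) ≤
        c * (1 + a) ^ 2 - (c - 1) * (c - 3) * (1 + a) + (c - 1) ^ 2 ∧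
      e * (1 + c * a) ≤ c * a ^ 2 - (c - 3) * a + 1 := by
  have hc6 : c < 6 := by nlinarith
  have he1 : e ≤ 1 / 250 := by nlinarith
  -- Crude bounds on the factors of `e`, namely 25 and 50 below, suffice because of the slack 1000.
  -- Multiplying by `4c` then completes each square.
  have hca : c * a ≤ 24 := by nlinarith
  have hq1 : e * (1 + c * a) ≤ c * a ^ 2 - (c ^ 2 - 4 * c + 1) * a + c := by
    have h1 : e * (1 + c * a) ≤ e * 25 := mul_le_mul_of_nonneg_left (by linarith) he.le
    have h2 : 4 * c * (c * a ^ 2 - (c ^ 2 - 4 * c + 1) * a + c) =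
        (2 * c * a - (c ^ 2 - 4 * c + 1)) ^ 2 + (6 * c - c ^ 2 - 1) * (c - 1) ^ 2 := by ring
    have h3 : 1000 * e * 16 ≤ (6 * c - c ^ 2 - 1) * (c - 1) ^ 2 :=
      mul_le_mul hce (by nlinarith) (by norm_num) (by linarith)
    have h4 : 4 * c * (e * 25) ≤ 4 * c * (c * a ^ 2 - (c ^ 2 - 4 * c + 1) * a + c) := by
      rw [h2]
      nlinarith [sq_nonneg (2 * c * a - (c ^ 2 - 4 * c + 1))]
    exact h1.trans (le_of_mul_le_mul_left h4 (by linarith))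
  have hq2 : e * ((c - 1) + c * (1 + a)) ≤
      c * (1 + a) ^ 2 - (c - 1) * (c - 3) * (1 + a) + (c - 1) ^ 2 := by
    have h1 : e * ((c - 1) + c * (1 + a)) ≤ e * 50 :=
      mul_le_mul_of_nonneg_left (by linarith) he.le
    have h2 : 4 * c * (c * (1 + a) ^ 2 - (c - 1) * (c - 3) * (1 + a) + (c - 1) ^ 2) =
        (2 * c * (1 + a) - (c - 1) * (c - 3)) ^ 2 + (c - 1) ^ 2 * (4 * c - (c - 3) ^ 2) := by ring
    have h3 : 16 * 1 ≤ (c - 1) ^ 2 * (4 * c - (c - 3) ^ 2) :=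
      mul_le_mul (by nlinarith) (by nlinarith) (by norm_num) (sq_nonneg _)
    have h4 : 4 * c * (e * 50) ≤
        4 * c * (c * (1 + a) ^ 2 - (c - 1) * (c - 3) * (1 + a) + (c - 1) ^ 2) := by
      rw [h2]
      nlinarith [sq_nonneg (2 * c * (1 + a) - (c - 1) * (c - 3))]
    exact h1.trans (le_of_mul_le_mul_left h4 (by linarith))
  have hq3 : e * (1 + c * a) ≤ c * a ^ 2 - (c - 3) * a + 1 := by
    have h1 : e * (1 + c * a) ≤ e * 25 := mul_le_mul_of_nonneg_left (by linarith) he.le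
    have h2 : 4 * c * (c * a ^ 2 - (c - 3) * a + 1) =
        (2 * c * a - (c - 3)) ^ 2 + (4 * c - (c - 3) ^ 2) := by ring
    have h4 : 4 * c * (e * 25) ≤ 4 * c * (c * a ^ 2 - (c - 3) * a + 1) := by
      rw [h2]
      nlinarith [sq_nonneg (2 * c * a - (c - 3))]
    exact h1.trans (le_of_mul_le_mul_left h4 (by linarith))
  exact ⟨hc6, he1, hq1, hq2, hq3⟩

/-- For `c < 3 + 2√2` the bound on the search trajectories improves by a fixed amount. -/
theorem SearchBound.improve {c a e : ℝ} {T : ℝ≥0} (hc : 5 ≤ c) (he : 0 < e)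
    (hce : 1000 * e ≤ 6 * c - c ^ 2 - 1)
    (hA : ∀ x : ℝ, 1 < |x| → A.evacuationTime x < ENNReal.ofReal (c * |x|))
    (ha0 : 0 ≤ a) (ha : a ≤ c - 2) (h : SearchBound A c a T) :
    ∃ T', SearchBound A c (a - e) T' := by
  obtain ⟨hc6, he1, hq1, hq2, hq3⟩ := improve_quadratics hc he hce ha
  -- Since `c - 1 < 5`, a visited point satisfies `|q| ≥ t / 5`, and unit speed gives `s ≥ |q|`. So
  -- the visit falls after `T`, where the old bounds hold.
  set T' : ℝ≥0 := 6 * (T + 1) with hT'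
  have hlate : ∀ (U t s : ℝ≥0) (p q : ℝ), 6 * (U + 1) ≤ t → |q| ≤ s →
      (c - 1) * |q| = t + |p| → U ≤ s := by
    intro U t s p q ht hqs hq
    have h1 : (6 * (U + 1) : ℝ) ≤ t := by exact_mod_cast ht
    have h2 := abs_nonneg p
    have h3 : (c - 1) * |q| ≤ 5 * |q| :=
      mul_le_mul_of_nonneg_right (by linarith) (abs_nonneg q)
    have h4 := U.coe_nonneg
    rw [← NNReal.coe_le_coe]
    linarith
  have hct : ∀ t : ℝ≥0, T' ≤ t → c - 1 < t := by
    intro t ht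
    have h1 : (6 * (T + 1) : ℝ) ≤ t := by exact_mod_cast ht
    have h4 := T.coe_nonneg
    linarith
  /- The bound that results from an earlier visit by the receiver. -/
  have hrec : ∀ t p q s : ℝ, 0 ≤ p → (c - 1) * q = t + p → q + s ≤ t - p → q ≤ a * s →
      p * (1 + c * a) ≤ t * ((c - 2) * a - 1) := by
    intro t p q s hp hq hqs hqa
    have h1 : (1 + a) * q ≤ a * (t - p) := by
      linarith [mul_le_mul_of_nonneg_left hqs ha0]
    have h2 : (c - 1) * ((1 + a) * q) ≤ (c - 1) * (a * (t - p)) :=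
      mul_le_mul_of_nonneg_left h1 (by linarith)
    have h3 : (c - 1) * ((1 + a) * q) = (1 + a) * (t + p) := by rw [← hq]; ring
    linarith
  have hden : 0 < 1 + c * a := by positivity
  have hsender : ∀ t, T' ≤ t → (c - 1) * |A.search .sender t| ≤ (1 + (a - e)) * t := by
    intro t ht
    obtain ⟨j, s, hst, hq, hor⟩ := exists_earlier_visit (by linarith) hA .sender (hct t ht)
    have hqs := (A.search_isTrajectory j).abs_le s
    have hTs := hlate T t s _ _ ht hqs hq
    have hvis : |A.search j s| + s ≤ t - |A.search .sender t| := by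
      rcases hor with ⟨h', -⟩ | h'
      · cases h'
      · exact h'
    have ht0 : (0 : ℝ) ≤ t := t.coe_nonneg
    set p := |A.search .sender t|
    have hp : 0 ≤ p := abs_nonneg _
    cases j
    · have hb := (h s hTs).2
      set q := |A.search .sender s|
      have h1 : t + p ≤ (1 + a) * (t - p - q) :=
        calc t + p ≤ (1 + a) * s := by rw [← hq]; exact hb
          _ ≤ _ := mul_le_mul_of_nonneg_left (by linarith) (by linarith)
      have h2 : (c - 1) * (t + p) ≤ (c - 1) * ((1 + a) * (t - p - q)) :=
        mul_le_mul_of_nonneg_left h1 (by linarith)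
      have h3 : (c - 1) * ((1 + a) * (t - p - q)) =
          (1 + a) * ((c - 1) * (t - p) - (t + p)) := by rw [← hq]; ring
      have h4 : p * ((c - 1) + c * (1 + a)) ≤ t * ((1 + a) * (c - 2) - (c - 1)) := by linarith
      have hden' : 0 < (c - 1) + c * (1 + a) := by
        have := mul_nonneg (show 0 ≤ c by linarith) ha0
        linarith
      refine le_of_mul_le_mul_right ?_ hden'
      have h5 := mul_le_mul_of_nonneg_left h4 (show 0 ≤ c - 1 by linarith)
      have h6 := mul_le_mul_of_nonneg_left hq2 ht0
      linarith
    · have h4 := hrec t p _ s hp hq hvis (h s hTs).1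
      refine le_of_mul_le_mul_right ?_ hden
      have h5 := mul_le_mul_of_nonneg_left h4 (show 0 ≤ c - 1 by linarith)
      have h6 := mul_le_mul_of_nonneg_left hq1 ht0
      linarith
  -- A second delay places the sender visits used by the receiver after `T'`, where the improved
  -- sender bound holds.
  refine ⟨6 * (T' + 1), fun t ht => ?_⟩
  have hT't : T' ≤ t := by
    refine le_trans ?_ ht
    rw [← NNReal.coe_le_coe]
    push_cast
    linarith [T'.coe_nonneg]
  refine ⟨?_, hsender t hT't⟩
  obtain ⟨j, s, hst, hq, hor⟩ := exists_earlier_visit (by linarith) hA .receiver (hct t hT't)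
  have hqs := (A.search_isTrajectory j).abs_le s
  have ht0 : (0 : ℝ) ≤ t := t.coe_nonneg
  cases j
  -- Wireless notice gives only `s ≤ t`, but `t + |p| = (c - 1)|q| ≤ (1 + a - e) s` already yields
  -- `|p| ≤ (a - e) t`. This dictates the slope chosen for the sender.
  · have hTs : T' ≤ s := hlate T' t s _ _ ht hqs hq
    have hb := hsender s hTs
    have hst' : (s : ℝ) ≤ t := by exact_mod_cast hst
    have h0 : 0 ≤ 1 + (a - e) := by linarith
    linarith [mul_le_mul_of_nonneg_left hst' h0]
  · have hvis : |A.search .receiver s| + s ≤ t - |A.search .receiver t| := by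
      rcases hor with ⟨-, h'⟩ | h'
      · cases h'
      · exact h'
    have hTs := hlate T t s _ _ hT't hqs hq
    have h4 := hrec t _ _ s (abs_nonneg _) hq hvis (h s hTs).1
    refine le_of_mul_le_mul_right ?_ hden
    have h6 := mul_le_mul_of_nonneg_left hq3 ht0
    linarith

theorem SearchBound.nonneg {c a : ℝ} {T : ℝ≥0} (h : SearchBound A c a T) : 0 ≤ a := by
  have h1 := (h (T + 1) (by simp)).1
  have h2 := abs_nonneg (A.search .receiver (T + 1))
  have h3 : (0 : ℝ) < (T + 1 : ℝ≥0) := by positivity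
  exact nonneg_of_mul_nonneg_left (h2.trans h1) h3

theorem not_forall_evacuationTime_lt {c : ℝ} (hc : 5 ≤ c) (hc' : c < 3 + 2 * √2)
    (hA : ∀ x : ℝ, 1 < |x| → A.evacuationTime x < ENNReal.ofReal (c * |x|)) : False := by
  have hpos : 0 < 6 * c - c ^ 2 - 1 := by
    nlinarith [sqrt_two_mul_self, one_lt_sqrt_two]
  set e := (6 * c - c ^ 2 - 1) / 1000 with he
  have he0 : 0 < e := by positivity
  have hbound : ∀ n : ℕ, ∃ T, SearchBound A c (c - 2 - n * e) T := by
    intro n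
    induction n with
    | zero =>
      -- At `a = c - 2` both bounds follow from unit speed.
      refine ⟨0, fun t _ => ?_⟩
      have h1 := (A.search_isTrajectory .receiver).abs_le t
      have h2 := (A.search_isTrajectory .sender).abs_le t
      have h3 := t.coe_nonneg
      simp only [Nat.cast_zero, zero_mul, sub_zero]
      constructor
      · nlinarith
      · nlinarith
    | succ n ih =>
      obtain ⟨T, hT⟩ := ih
      have hn : (0 : ℝ) ≤ n * e := by positivity
      obtain ⟨T', hT'⟩ := hT.improve hc he0 (by rw [he]; linarith) hA hT.nonneg (by linarith)
      refine ⟨T', ?_⟩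
      convert hT' using 1
      push_cast
      ring
  obtain ⟨n, hn⟩ := exists_nat_gt ((c - 2) / e)
  rw [div_lt_iff₀ he0] at hn
  obtain ⟨T, hT⟩ := hbound n
  linarith [hT.nonneg]

/-- The lower bound for every evacuation algorithm. -/
theorem le_competitiveRatio (A : EvacuationAlgorithm) :
    ENNReal.ofReal (3 + 2 * √2) ≤ A.competitiveRatio := by
  by_contra hlt
  rw [not_le] at hlt
  obtain ⟨b, hb⟩ : ∃ b, A.competitiveRatio = ENNReal.ofReal b :=
    ⟨_, (ENNReal.ofReal_toReal hlt.ne_top).symm⟩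
  have hs := one_lt_sqrt_two
  rw [hb, ENNReal.ofReal_lt_ofReal_iff (by linarith)] at hlt
  -- Raising `c` to at least 5 only weakens the evacuation hypothesis and supplies the numerical
  -- bounds.
  obtain ⟨c, hc1, hc2⟩ := exists_between (max_lt hlt (show (5 : ℝ) < 3 + 2 * √2 by linarith))
  obtain ⟨hbc, h5c⟩ := max_lt_iff.mp hc1
  refine not_forall_evacuationTime_lt (A := A) h5c.le hc2 fun x hx => ?_
  have hx0 : 0 < |x| := by linarith
  have h1 : A.evacuationTime x / ENNReal.ofReal |x| < ENNReal.ofReal c := by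
    have h2 : A.evacuationTime x / ENNReal.ofReal |x| ≤ A.competitiveRatio :=
      le_iSup₂_of_le x hx le_rfl
    refine h2.trans_lt ?_
    rw [hb]
    exact (ENNReal.ofReal_lt_ofReal_iff (by linarith)).mpr hbc
  rw [ENNReal.ofReal_mul (by linarith)]
  exact (ENNReal.div_lt_iff (.inl (by simpa using hx0)) (.inl ENNReal.ofReal_ne_top)).mp h1

end EvacuationAlgorithm

/-! ### The evacuation time of the optimal algorithm -/

theorem goTo_eq_of_le {p q d : ℝ} (h : |q - p| ≤ d) : goTo p q d = q := by
  rw [abs_le] at h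
  unfold goTo
  split_ifs
  · exact min_eq_left (by linarith)
  · exact max_eq_left (by linarith)

/-- The algorithm evacuates from `x` by time `(3 + 2√2)|x|`. -/
theorem optRun_eq {x : ℝ} (i : Agent) {t : ℝ≥0} (ht : (t : ℝ) = (3 + 2 * √2) * |x|) :
    optRun x i t = x := by
  have h1 := one_lt_sqrt_two
  have h2 := sqrt_two_mul_self
  rcases le_or_gt 0 x with hx | hx
  · rw [abs_of_nonneg hx] at ht
    have hs : senderFindTime x = (1 + √2) * x := by
      rw [senderFindTime, div_eq_iff (by linarith)]
      linear_combination -x * h2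
    -- Notice comes at time `(1 + √2)x`, when the receiver is `(2 + √2)x` away from the target.
    have hle : |x - -senderFindTime x| ≤ t - senderFindTime x := by
      rw [hs, ht, abs_of_nonneg (by nlinarith)]
      linarith
    cases i
    · simp only [optRun, if_pos hx]
      split_ifs with h
      · have h3 : x = 0 := by
          rw [ht, hs] at h
          nlinarith
        subst h3
        simp [ht]
      · rfl
    · simp only [optRun, if_pos hx]
      split_ifs with h
      · have h3 : x = 0 := by
          rw [ht, hs] at h
          nlinarith
        subst h3
        simp [ht]
      · exact goTo_eq_of_le hle
  · rw [abs_of_neg hx] at ht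
    have hx' : ¬ 0 ≤ x := not_le.mpr hx
    have hm : ¬ (t : ℝ) ≤ meetTime x := by
      rw [ht, meetTime]
      nlinarith
    have hr : ¬ (t : ℝ) ≤ -x := by
      rw [ht]
      nlinarith
    -- The agents meet at `√2|x|` at time `(2 + √2)|x|`, leaving a distance `(1 + √2)|x|` to the
    -- target.
    have hle : |x - (√2 - 1) * meetTime x| ≤ t - meetTime x := by
      have h3 : (√2 - 1) * meetTime x = √2 * -x := by
        rw [meetTime]
        linear_combination -x * h2
      rw [h3, ht, meetTime, abs_of_nonpos (by nlinarith)]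
      linarith
    cases i
    · simpa only [optRun, if_neg hx', if_neg hm] using goTo_eq_of_le hle
    · simpa only [optRun, if_neg hx', if_neg hm, if_neg hr] using goTo_eq_of_le hle

theorem competitiveRatio_optAlgorithm_le :
    optAlgorithm.competitiveRatio ≤ ENNReal.ofReal (3 + 2 * √2) := by
  refine iSup₂_le fun x hx => ?_
  refine ENNReal.div_le_of_le_mul (iSup_le fun i => ?_)
  rw [← ENNReal.ofReal_mul (by positivity)]
  refine iInf₂_le (Real.toNNReal ((3 + 2 * √2) * |x|)) ?_
  exact optRun_eq i (Real.coe_toNNReal _ (by positivity))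

theorem mainTheorem3 :
    optAlgorithm.competitiveRatio = ENNReal.ofReal (3 + 2 * √2) ∧
      ∀ A : EvacuationAlgorithm, optAlgorithm.competitiveRatio ≤ A.competitiveRatio :=
  ⟨le_antisymm competitiveRatio_optAlgorithm_le optAlgorithm.le_competitiveRatio,
    fun A => competitiveRatio_optAlgorithm_le.trans A.le_competitiveRatio⟩
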